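/- Let $K$ be a field (for example $\mathbb{R}$ or $\mathbb{C}$) and let $k\ge 2$. Let $v_0,v_1,\dots,v_{2k-1}$ be distinct points of the projective plane $\mathbb{P}^2$ over $K$ lying on an irreducible conic, that is, on the zero set of a homogeneous quadratic polynomial that is irreducible in $K[x,y,z]$. Regard them as the consecutive vertices of a closed $2k$-gon (indices modulo $2k$), and color its edges alternately: the lines $v_{2i}v_{2i+1}$ are red and the lines $v_{2i+1}v_{2i+2}$ are blue, for $0\le i<k$. Let $\Gamma$ be the set of points, other than the vertices, that lie on both a red line and a blue line; there are $k^2-2k$ of them when they are counted as intersections of non-adjacent red and blue edges. Suppose that a (green) line $G$ contains a set $S$ of $k-1$ distinct points of $\Gamma$. 1. If the $k^2-2k$ intersection points are distinct, i.e. $|\Gamma|=k^2-2k$, then another point of $\Gamma$, not in $S$, also lies on $G$. 2. In general (with no assumption that the intersection points are distinct), either another point of $\Gamma$, not in $S$, lies on $G$, or some point of $S$ lies on at least two red lines and on at least two blue lines. -/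

import Mathlib

open scoped LinearAlgebra.Projectivization

/-- The projective plane over `K`. -/
abbrev ProjPlane (K : Type*) [Field K] : Type _ := ℙ K (Fin 3 → K)

/-- The plane curve `F = 0` (meant for homogeneous `F`, for which the condition does not depend on
the chosen representative). -/
def planeCurve {K : Type*} [Field K] (F : MvPolynomial (Fin 3) K) : Set (ProjPlane K) :=
  {P | MvPolynomial.eval P.rep F = 0}

/-- `G` is a line `a x + b y + c z = 0` with `(a, b, c) ≠ 0`. -/
def IsPlaneLine {K : Type*} [Field K] (G : Set (ProjPlane K)) : Prop :=
  ∃ a : Fin 3 → K, a ≠ 0 ∧ G = {P | a ⬝ᵥ P.rep = 0}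

/-- The line through two distinct points `P` and `Q`. -/
def lineThrough {K : Type*} [Field K] (P Q : ProjPlane K) : Set (ProjPlane K) :=
  {X | X.submodule ≤ P.submodule ⊔ Q.submodule}

/-- A closed polygon with `2 k` sides has vertices `v 0, v 1, …, v (2 k - 1)`, indexed cyclically.
Its red edges are those from `v (2 i)` to `v (2 i + 1)`; this is the `i`-th red edge, extended to a
line. -/
def redLine {K : Type*} [Field K] {k : ℕ} (v : ZMod (2 * k) → ProjPlane K) (i : Fin k) :
    Set (ProjPlane K) :=
  lineThrough (v ((2 * i.val : ℕ) : ZMod (2 * k))) (v ((2 * i.val + 1 : ℕ) : ZMod (2 * k)))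

/-- The blue edges are those from `v (2 i + 1)` to `v (2 i + 2)`; this is the `i`-th blue edge,
extended to a line. -/
def blueLine {K : Type*} [Field K] {k : ℕ} (v : ZMod (2 * k) → ProjPlane K) (i : Fin k) :
    Set (ProjPlane K) :=
  lineThrough (v ((2 * i.val + 1 : ℕ) : ZMod (2 * k))) (v ((2 * i.val + 2 : ℕ) : ZMod (2 * k)))

/-- The points, other than the vertices, in which a red line meets a blue line. -/
def crossingPoints {K : Type*} [Field K] {k : ℕ} (v : ZMod (2 * k) → ProjPlane K) :
    Set (ProjPlane K) :=
  {X | (∃ i, X ∈ redLine v i) ∧ (∃ j, X ∈ blueLine v j) ∧ X ∉ Set.range v}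

open MvPolynomial Matrix

/-! In suitable coordinates the conic is `x z = y²` and every vertex is given by a parameter. With
the sides normalized as in `chord`, the product of the red forms minus the product of the blue forms
is the equation of the conic times a cofactor `D` of degree `k - 2` (`exists_cofactor`). Crossing
points are off the conic, so `D` vanishes at the `k - 1` points of `S`; restricted to `G` it has
more zeros than its degree, hence is zero there. As `D` is nonzero at every vertex
(`eval_cofactor_ne_zero`), `G` contains no vertex, and on `G` the red and blue products are equal
products of `k` nonzero linear forms (`prod_restrictToLine_eq`).

By unique factorization every red line meets `G` in a point of a blue line, which is a crossing
point. If all these points are in `S`, two of the `k` red lines meet `G` in the same point, and by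
equality of multiplicities so do two blue lines (`exists_mem_two_lines`). Then different pairs of
non-adjacent edges share a crossing point, and there are fewer than `k² - 2k` of them
(`ncard_crossingPoints_lt`); so the second claim implies the first. -/

/-- The linear form `∑ i, a i * X i`. -/
noncomputable def linForm {R σ : Type*} [CommRing R] [Fintype σ] (a : σ → R) : MvPolynomial σ R :=
  ∑ i, C (a i) * X i

/-! ### Linear forms as polynomials. -/

section LinForm

variable {R σ : Type*} [CommRing R] [Fintype σ]

lemma aeval_linForm {A : Type*} [CommRing A] [Algebra R A] (f : σ → A) (a : σ → R) :
    aeval f (linForm a) = ∑ i, algebraMap R A (a i) * f i := by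
  simp [linForm]

lemma eval_linForm (f a : σ → R) : eval f (linForm a) = a ⬝ᵥ f := by
  simp [linForm, dotProduct]

@[simp]
lemma constantCoeff_linForm (a : σ → R) : constantCoeff (linForm a) = 0 := by
  simp [linForm]

lemma linForm_isHomogeneous (a : σ → R) : (linForm a).IsHomogeneous 1 := by
  refine IsHomogeneous.sum _ _ _ fun i _ => ?_
  simpa using (isHomogeneous_C σ (a i)).mul (isHomogeneous_X R i)

lemma coeff_linForm [DecidableEq σ] (a : σ → R) (i : σ) :
    coeff (Finsupp.single i 1) (linForm a) = a i := by
  simp [linForm, coeff_sum, coeff_C_mul, coeff_X, Finsupp.single_left_inj]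

lemma linForm_ne_zero {a : σ → R} (ha : a ≠ 0) : linForm a ≠ 0 := by
  classical
  obtain ⟨i, hi⟩ := Function.ne_iff.mp ha
  intro h
  apply hi
  simpa [h] using (coeff_linForm a i).symm

lemma linForm_irreducible {K : Type*} [Field K] {a : σ → K} (ha : a ≠ 0) :
    Irreducible (linForm a) := by
  classical
  refine irreducible_of_totalDegree_eq_one
    ((linForm_isHomogeneous a).totalDegree (linForm_ne_zero ha)) fun x hx => ?_
  obtain ⟨i, hi⟩ := Function.ne_iff.mp ha
  have h := hx (Finsupp.single i 1)
  rw [coeff_linForm] at h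
  exact isUnit_of_dvd_unit h (isUnit_iff_ne_zero.mpr hi)

end LinForm

/-! ### Ternary quadratic forms and irreducibility. -/

section Quadratic

/-- A homogeneous quadratic polynomial comes from a matrix. -/
lemma MvPolynomial.IsHomogeneous.exists_matrix {R σ : Type*} [CommRing R] [Fintype σ]
    {F : MvPolynomial σ R} (hF : F.IsHomogeneous 2) :
    ∃ M : Matrix σ σ R, F = X ⬝ᵥ (M.map C) *ᵥ X := by
  classical
  let p : MvPolynomial σ R → Prop := fun F => ∃ M : Matrix σ σ R, F = X ⬝ᵥ (M.map C) *ᵥ X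
  change p F
  rw [F.as_sum]
  refine Finset.sum_induction _ p ?_ ?_ ?_
  · rintro _ _ ⟨M, rfl⟩ ⟨N, rfl⟩
    exact ⟨M + N, by rw [Matrix.map_add C (by simp), add_mulVec, dotProduct_add]⟩
  · exact ⟨0, by simp⟩
  · intro d hd
    have hdeg : d.degree = 2 := by
      rw [Finsupp.degree_eq_weight_one]
      exact hF (mem_support_iff.mp hd)
    obtain ⟨i, hi⟩ : ∃ i, d i ≠ 0 := by
      by_contra! h
      have : d = 0 := Finsupp.ext h
      simp [this] at hdeg
    obtain ⟨e, rfl⟩ : ∃ e, d = e + Finsupp.single i 1 :=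
      ⟨d - Finsupp.single i 1, (tsub_add_cancel_of_le (by
        simpa [Finsupp.single_le_iff] using Nat.one_le_iff_ne_zero.mpr hi)).symm⟩
    have he : e.degree = 1 := by
      simpa using hdeg
    obtain ⟨j, rfl⟩ : ∃ j, e = Finsupp.single j 1 := by
      obtain ⟨j, hj⟩ : ∃ j, e j ≠ 0 := by
        by_contra! h
        have : e = 0 := Finsupp.ext h
        simp [this] at he
      obtain ⟨f, rfl⟩ : ∃ f, e = f + Finsupp.single j 1 :=
        ⟨e - Finsupp.single j 1, (tsub_add_cancel_of_le (by
          simpa [Finsupp.single_le_iff] using Nat.one_le_iff_ne_zero.mpr hj)).symm⟩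
      have hf : f = 0 := (Finsupp.degree_eq_zero_iff f).mp (by simpa using he)
      exact ⟨j, by simp [hf]⟩
    -- The matrix need not be symmetric. Nothing is divided by 2, so characteristic 2 is allowed.
    refine ⟨Matrix.single j i (coeff (Finsupp.single j 1 + Finsupp.single i 1) F), ?_⟩
    rw [Matrix.map_single _ _ _ (C : R →+* _), dotProduct, Finset.sum_eq_single j]
    · rw [mulVec, dotProduct, Finset.sum_eq_single i]
      · simp [monomial_eq, Finsupp.prod_add_index', pow_add]
        ring
      · intro b _ hb
        simp [Matrix.single, hb.symm]
      · simp
    · intro b _ hb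
      simp [mulVec, dotProduct, Matrix.single, hb.symm]
    · simp

/-- The value of the quadratic form of a matrix on a combination of three vectors. -/
lemma dotProduct_mulVec_combination {R n : Type*} [CommRing R] [Fintype n] (M : Matrix n n R)
    (P Q S : n → R) (a b c : R) :
    (a • P + b • Q + c • S) ⬝ᵥ M *ᵥ (a • P + b • Q + c • S) =
      a ^ 2 * (P ⬝ᵥ M *ᵥ P) + b ^ 2 * (Q ⬝ᵥ M *ᵥ Q) + c ^ 2 * (S ⬝ᵥ M *ᵥ S) +
      a * b * (P ⬝ᵥ M *ᵥ Q + Q ⬝ᵥ M *ᵥ P) + a * c * (P ⬝ᵥ M *ᵥ S + S ⬝ᵥ M *ᵥ P) +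
      b * c * (Q ⬝ᵥ M *ᵥ S + S ⬝ᵥ M *ᵥ Q) := by
  simp only [mulVec_add, mulVec_smul, add_dotProduct, dotProduct_add, smul_dotProduct,
    dotProduct_smul, smul_eq_mul]
  ring

/-- Cramer's rule in three dimensions, in terms of cross products. -/
lemma cramer_crossProduct {R : Type*} [CommRing R] (P Q S x : Fin 3 → R) :
    (crossProduct P Q ⬝ᵥ S) • x = (crossProduct Q S ⬝ᵥ x) • P + (crossProduct S P ⬝ᵥ x) • Q +
      (crossProduct P Q ⬝ᵥ x) • S := by
  ext i
  simp only [cross_apply, dotProduct, Fin.sum_univ_three, Pi.add_apply, Pi.smul_apply, smul_eq_mul]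
  fin_cases i <;> simp <;> ring

lemma exists_dotProduct_ne_zero {R n : Type*} [CommRing R] [Fintype n] {a : n → R} (ha : a ≠ 0) :
    ∃ x, a ⬝ᵥ x ≠ 0 := by
  by_contra! h
  exact ha (dotProduct_eq_zero a h)

lemma map_C_dotProduct_X {R σ : Type*} [CommRing R] [Fintype σ] (a : σ → R) :
    (fun i => C (a i)) ⬝ᵥ (X : σ → MvPolynomial σ R) = linForm a := rfl

/-- Two independent isotropic vectors of an irreducible ternary quadratic form are not
orthogonal. -/
lemma polar_ne_zero_of_irreducible {K : Type*} [Field K] {M : Matrix (Fin 3) (Fin 3) K}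
    (hirr : Irreducible (X ⬝ᵥ (M.map C) *ᵥ X : MvPolynomial (Fin 3) K)) {P Q : Fin 3 → K}
    (hPQ : LinearIndependent K ![P, Q]) (hP : P ⬝ᵥ M *ᵥ P = 0) (hQ : Q ⬝ᵥ M *ᵥ Q = 0) :
    P ⬝ᵥ M *ᵥ Q + Q ⬝ᵥ M *ᵥ P ≠ 0 := by
  intro hpol
  obtain ⟨S, hS⟩ := exists_dotProduct_ne_zero (crossProduct_ne_zero_iff_linearIndependent.mpr hPQ)
  let c : (Fin 3 → K) → Fin 3 → MvPolynomial (Fin 3) K := fun a i => C (a i)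
  have hcross (a b : Fin 3 → K) : crossProduct (c a) (c b) = c (crossProduct a b) := by
    ext1 i
    simp only [c, cross_apply]
    fin_cases i <;> simp
  have hquad (a b : Fin 3 → K) : c a ⬝ᵥ (M.map C) *ᵥ c b = C (a ⬝ᵥ M *ᵥ b) := by
    simp [c, dotProduct, mulVec]
  have hdot (a b : Fin 3 → K) : c a ⬝ᵥ c b = C (a ⬝ᵥ b) := by
    simp [c, dotProduct]
  -- Cramer's rule over the polynomial ring expands the generic point `X` in the basis `P, Q, S`.
  -- The coefficients of the terms in `P, Q` alone vanish, so every remaining term contains `linForm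
  -- (crossProduct P Q)`: the conic would split off a line.
  have key := dotProduct_mulVec_combination (M.map C) (c P) (c Q) (c S)
    (crossProduct (c Q) (c S) ⬝ᵥ X) (crossProduct (c S) (c P) ⬝ᵥ X) (crossProduct (c P) (c Q) ⬝ᵥ X)
  rw [← cramer_crossProduct] at key
  simp only [hcross, hquad, ← C_add, hpol, hP, hQ, hdot, mulVec_smul, smul_dotProduct,
    dotProduct_smul, smul_eq_mul, c, map_C_dotProduct_X, C_0, mul_zero, zero_add] at key
  set Δ := crossProduct P Q ⬝ᵥ S
  have hfac : X ⬝ᵥ (M.map C) *ᵥ X = linForm (crossProduct P Q) * (C (Δ⁻¹ ^ 2) *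
      (linForm (crossProduct P Q) * C (S ⬝ᵥ M *ᵥ S) +
        linForm (crossProduct Q S) * C (P ⬝ᵥ M *ᵥ S + S ⬝ᵥ M *ᵥ P) +
        linForm (crossProduct S P) * C (Q ⬝ᵥ M *ᵥ S + S ⬝ᵥ M *ᵥ Q))) := by
    have h1 : C (Δ⁻¹ ^ 2) * (C Δ * (C Δ * (X ⬝ᵥ (M.map C) *ᵥ X : MvPolynomial (Fin 3) K))) =
        X ⬝ᵥ (M.map C) *ᵥ X := by
      rw [← mul_assoc, ← mul_assoc, ← C_mul, ← C_mul]
      have : Δ⁻¹ ^ 2 * Δ * Δ = 1 := by field_simp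
      rw [this, C_1, one_mul]
    rw [← h1, key]
    ring
  rw [hfac] at hirr
  have hz (p : MvPolynomial (Fin 3) K) (hp : eval 0 p = 0) : ¬ IsUnit p := fun h => by
    have := h.map (eval 0)
    rw [hp] at this
    exact not_isUnit_zero this
  rcases hirr.isUnit_or_isUnit rfl with h | h
  · exact hz _ (by simp) h
  · exact hz _ (by simp) h

end Quadratic

/-! ### Normal form and parametrization of an irreducible conic. -/

section Conic

/-- The parametrization `(s, t) ↦ (s², s t, t²)` of the conic `x z = y²`. -/
def veronese {R : Type*} [CommRing R] (p : R × R) : Fin 3 → R :=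
  ![p.1 ^ 2, p.1 * p.2, p.2 ^ 2]

/-- The linear form of the line joining the points with parameters `p` and `q` of the conic. -/
def chord {R : Type*} [CommRing R] (p q : R × R) : Fin 3 → R :=
  ![p.2 * q.2, -(p.1 * q.2 + p.2 * q.1), p.1 * q.1]

/-- The determinant of two parameters. -/
def bracket {R : Type*} [CommRing R] (p q : R × R) : R :=
  p.1 * q.2 - p.2 * q.1

section Ring

variable {R : Type*} [CommRing R]

lemma crossProduct_veronese (p q : R × R) :
    crossProduct (veronese p) (veronese q) = bracket p q • chord p q := by
  ext i
  simp only [cross_apply, veronese, chord, bracket]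
  fin_cases i <;> simp <;> ring

lemma chord_dotProduct_veronese (p q r : R × R) :
    chord p q ⬝ᵥ veronese r = bracket p r * bracket q r := by
  simp [chord, veronese, bracket, dotProduct, Fin.sum_univ_three]
  ring

lemma chord_comm (p q : R × R) : chord p q = chord q p := by
  ext i
  fin_cases i <;> simp [chord] <;> ring

@[simp]
lemma bracket_self (p : R × R) : bracket p p = 0 := by
  simp [bracket, mul_comm]

end Ring

variable {K : Type*} [Field K]

lemma exists_smul_veronese {y : Fin 3 → K} (h : y 0 * y 2 = y 1 ^ 2) :
    ∃ (c : K) (p : K × K), y = c • veronese p := by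
  by_cases h0 : y 0 = 0
  · have h1 : y 1 = 0 := by simpa [h0] using h.symm
    refine ⟨y 2, (0, 1), ?_⟩
    ext i
    fin_cases i <;> simp [veronese, h0, h1]
  · refine ⟨(y 0)⁻¹, (y 0, y 1), ?_⟩
    ext i
    fin_cases i
    · simp [veronese]; field_simp
    · simp [veronese]; field_simp
    · simp [veronese, ← h]; field_simp

/-- A line meets an irreducible conic in at most two points. -/
lemma crossProduct_dotProduct_ne_zero {M : Matrix (Fin 3) (Fin 3) K} {P Q S : Fin 3 → K}
    (hP : P ⬝ᵥ M *ᵥ P = 0) (hQ : Q ⬝ᵥ M *ᵥ Q = 0) (hS : S ⬝ᵥ M *ᵥ S = 0)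
    (hpol : P ⬝ᵥ M *ᵥ Q + Q ⬝ᵥ M *ᵥ P ≠ 0) (hPQ : LinearIndependent K ![P, Q])
    (hPS : LinearIndependent K ![P, S]) (hQS : LinearIndependent K ![Q, S]) :
    crossProduct P Q ⬝ᵥ S ≠ 0 := by
  intro h0
  obtain ⟨T, hT⟩ := exists_dotProduct_ne_zero (crossProduct_ne_zero_iff_linearIndependent.mpr hPQ)
  have hc := cramer_crossProduct P Q T S
  have key := dotProduct_mulVec_combination M P Q T (crossProduct Q T ⬝ᵥ S)
    (crossProduct T P ⬝ᵥ S) (crossProduct P Q ⬝ᵥ S)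
  rw [← hc] at key
  simp only [mulVec_smul, smul_dotProduct, dotProduct_smul, smul_eq_mul, hP, hQ, hS, h0, mul_zero,
    zero_mul, add_zero, zero_add, ne_eq, OfNat.ofNat_ne_zero, not_false_eq_true, zero_pow] at key
  -- Since `S` is in the span of `P` and `Q`, the form at `S` is the product of its two coordinates
  -- times the polar value. One coordinate is thus zero, and `S` is proportional to `P` or `Q`.
  rcases mul_eq_zero.mp ((mul_eq_zero.mp key.symm).resolve_right hpol) with h | h
  · rw [h, h0, zero_smul, zero_smul, zero_add, add_zero] at hc
    have := LinearIndependent.pair_iff.mp hQS (-(crossProduct T P ⬝ᵥ S)) (crossProduct P Q ⬝ᵥ T)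
      (by rw [hc, ← add_smul]; simp)
    exact hT this.2
  · rw [h, h0, zero_smul, zero_smul, add_zero, add_zero] at hc
    have := LinearIndependent.pair_iff.mp hPS (-(crossProduct Q T ⬝ᵥ S)) (crossProduct P Q ⬝ᵥ T)
      (by rw [hc, ← add_smul]; simp)
    exact hT this.2

/-- Coordinates in which a conic through three points has the equation `x z = y²`. -/
lemma exists_conic_coordinates {M : Matrix (Fin 3) (Fin 3) K} {P Q S : Fin 3 → K}
    (hP : P ⬝ᵥ M *ᵥ P = 0) (hQ : Q ⬝ᵥ M *ᵥ Q = 0) (hS : S ⬝ᵥ M *ᵥ S = 0)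
    (hPQ : P ⬝ᵥ M *ᵥ Q + Q ⬝ᵥ M *ᵥ P ≠ 0) (hPS : P ⬝ᵥ M *ᵥ S + S ⬝ᵥ M *ᵥ P ≠ 0)
    (hQS : Q ⬝ᵥ M *ᵥ S + S ⬝ᵥ M *ᵥ Q ≠ 0) (hdet : crossProduct P Q ⬝ᵥ S ≠ 0) :
    ∃ N : (Fin 3 → K) ≃ₗ[K] (Fin 3 → K),
      ∀ x, x ⬝ᵥ M *ᵥ x = 0 → N x 0 * N x 2 = N x 1 ^ 2 := by
  set a := P ⬝ᵥ M *ᵥ Q + Q ⬝ᵥ M *ᵥ P with ha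
  set b := P ⬝ᵥ M *ᵥ S + S ⬝ᵥ M *ᵥ P with hb
  set c := Q ⬝ᵥ M *ᵥ S + S ⬝ᵥ M *ᵥ Q with hc
  -- The outer vectors are multiples of `Q` and `S`, the middle one is the intersection of the
  -- tangents there. The scaling gives a multiple of `P` the coordinates `(1, -1, 1)`.
  let e : Fin 3 → Fin 3 → K := ![(-b) • Q, c • P + (-b) • Q + (-a) • S, (-a) • S]
  have hli : LinearIndependent K e := by
    have : LinearIndependent K (Matrix.row (Matrix.of e)) := by
      rw [Matrix.linearIndependent_rows_iff_isUnit, Matrix.isUnit_iff_isUnit_det,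
        isUnit_iff_ne_zero]
      have : (Matrix.of e).det = -(a * b * c * (crossProduct P Q ⬝ᵥ S)) := by
        simp [e, Matrix.det_fin_three, cross_apply, dotProduct, Fin.sum_univ_three]
        ring
      rw [this, neg_ne_zero]
      exact mul_ne_zero (mul_ne_zero (mul_ne_zero hPQ hPS) hQS) hdet
    exact this
  let B := basisOfLinearIndependentOfCardEqFinrank hli (by simp)
  refine ⟨B.equivFun, fun x hx => ?_⟩
  set y := B.equivFun x with hy
  have hxy : x = (c * y 1) • P + (-b * (y 0 + y 1)) • Q + (-a * (y 1 + y 2)) • S := by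
    rw [← B.sum_equivFun x, ← hy]
    simp only [B, coe_basisOfLinearIndependentOfCardEqFinrank, Fin.sum_univ_three, e,
      Matrix.cons_val_zero, Matrix.cons_val_one, Matrix.cons_val]
    module
  rw [hxy, dotProduct_mulVec_combination, hP, hQ, hS, ← ha, ← hb, ← hc] at hx
  have : a * b * c * (y 0 * y 2 - y 1 ^ 2) = 0 := by
    rw [← hx]
    ring
  have habc := mul_ne_zero (mul_ne_zero hPQ hPS) hQS
  exact sub_eq_zero.mp ((mul_eq_zero.mp this).resolve_left habc)

lemma linearIndependent_rep {P Q : ProjPlane K} (h : P ≠ Q) :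
    LinearIndependent K ![P.rep, Q.rep] :=
  Projectivization.linearIndependent_pair_iff_ne.mpr h

lemma linearIndependent_pair_map {V W : Type*} [AddCommGroup V] [Module K V] [AddCommGroup W]
    [Module K W] (N : V ≃ₗ[K] W) {x y : V} (h : LinearIndependent K ![x, y]) :
    LinearIndependent K ![N x, N y] := by
  have hN : ![N x, N y] = N.toLinearMap ∘ ![x, y] := by
    ext1 i
    fin_cases i <;> rfl
  exact hN ▸ h.map' N.toLinearMap N.ker

/-- A conic through three points has the standard parametrization in suitable coordinates. -/
theorem exists_conic_parametrization {F : MvPolynomial (Fin 3) K} (hF : F.IsHomogeneous 2)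
    (hirr : Irreducible F) {ι : Type*} {v : ι → ProjPlane K} (hv : Function.Injective v)
    (hconic : ∀ m, v m ∈ planeCurve F) {i j l : ι} (hij : i ≠ j) (hil : i ≠ l) (hjl : j ≠ l) :
    ∃ (N : (Fin 3 → K) ≃ₗ[K] (Fin 3 → K)) (p : ι → K × K) (c : ι → K),
      ∀ m, N (v m).rep = c m • veronese (p m) := by
  obtain ⟨M, rfl⟩ := hF.exists_matrix
  have hM (m : ι) : (v m).rep ⬝ᵥ M *ᵥ (v m).rep = 0 := by
    have : eval (v m).rep (X ⬝ᵥ (M.map C) *ᵥ X) = 0 := hconic m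
    simpa [dotProduct, mulVec] using this
  have hpol {m n : ι} (h : m ≠ n) := polar_ne_zero_of_irreducible hirr
    (linearIndependent_rep (hv.ne h)) (hM m) (hM n)
  obtain ⟨N, hN⟩ := exists_conic_coordinates (hM i) (hM j) (hM l) (hpol hij) (hpol hil) (hpol hjl)
    (crossProduct_dotProduct_ne_zero (hM i) (hM j) (hM l) (hpol hij)
      (linearIndependent_rep (hv.ne hij)) (linearIndependent_rep (hv.ne hil))
      (linearIndependent_rep (hv.ne hjl)))
  choose c p hp using fun m => exists_smul_veronese (hN _ (hM m))
  exact ⟨N, p, c, hp⟩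

lemma bracket_smul_chord_ne_zero {N : (Fin 3 → K) ≃ₗ[K] (Fin 3 → K)} {P Q : ProjPlane K}
    (h : P ≠ Q) {c d : K} {p q : K × K} (hP : N P.rep = c • veronese p)
    (hQ : N Q.rep = d • veronese q) : bracket p q • chord p q ≠ 0 := by
  have := crossProduct_ne_zero_iff_linearIndependent.mpr
    (linearIndependent_pair_map N (linearIndependent_rep h))
  rw [hP, hQ, map_smul, map_smul, LinearMap.smul_apply, crossProduct_veronese] at this
  exact right_ne_zero_of_smul (right_ne_zero_of_smul this)

lemma bracket_ne_zero {N : (Fin 3 → K) ≃ₗ[K] (Fin 3 → K)} {P Q : ProjPlane K}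
    (h : P ≠ Q) {c d : K} {p q : K × K} (hP : N P.rep = c • veronese p)
    (hQ : N Q.rep = d • veronese q) : bracket p q ≠ 0 :=
  left_ne_zero_of_smul (bracket_smul_chord_ne_zero h hP hQ)

lemma chord_ne_zero {N : (Fin 3 → K) ≃ₗ[K] (Fin 3 → K)} {P Q : ProjPlane K}
    (h : P ≠ Q) {c d : K} {p q : K × K} (hP : N P.rep = c • veronese p)
    (hQ : N Q.rep = d • veronese q) : chord p q ≠ 0 :=
  right_ne_zero_of_smul (bracket_smul_chord_ne_zero h hP hQ)

/-- A nonzero linear form that vanishes at two points is an equation of the line joining them. -/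
lemma mem_lineThrough_iff {P Q : ProjPlane K} (hPQ : P ≠ Q) {f : Module.Dual K (Fin 3 → K)}
    (hf : f ≠ 0) (hP : f P.rep = 0) (hQ : f Q.rep = 0) (x : ProjPlane K) :
    x ∈ lineThrough P Q ↔ f x.rep = 0 := by
  have hspan : P.submodule ⊔ Q.submodule = Submodule.span K (Set.range ![P.rep, Q.rep]) := by
    rw [P.submodule_eq, Q.submodule_eq, ← Submodule.span_union]
    simp
  have hker : Submodule.span K (Set.range ![P.rep, Q.rep]) = LinearMap.ker f := by
    apply Submodule.eq_of_le_of_finrank_eq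
    · rw [Submodule.span_le]
      rintro _ ⟨i, rfl⟩
      fin_cases i <;> simpa
    · rw [finrank_span_eq_card (linearIndependent_rep hPQ)]
      have := Module.Dual.finrank_ker_add_one_of_ne_zero hf
      simp at this ⊢
      omega
  rw [lineThrough, Set.mem_ofPred_eq, hspan, hker, x.submodule_eq, Submodule.span_singleton_le_iff_mem,
    LinearMap.mem_ker]

end Conic

/-! ### The cofactor of the conic in the difference of the red and blue products. -/

section Cofactor

variable {K : Type*} [Field K]

/-- The equation `x z - y²` of the standard conic. -/
noncomputable def conicForm (K : Type*) [Field K] : MvPolynomial (Fin 3) K :=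
  X 0 * X 2 - X 1 ^ 2

/-- The two pairs of opposite sides of an inscribed quadrilateral are degenerate members of the
pencil of conics through its vertices, which also contains the conic. Each parameter occurs once in
both products, so no scaling factors are needed. -/
lemma linForm_chord_mul_sub (a b c d : K × K) :
    linForm (chord a b) * linForm (chord c d) - linForm (chord b c) * linForm (chord d a) =
      conicForm K * C (bracket a c * bracket b d) := by
  simp [linForm, chord, bracket, conicForm, Fin.sum_univ_three]
  ring

/-- For a closed polygon inscribed in the conic, the products of the equations of the red and the
blue edges differ by a multiple of the equation of the conic. -/
lemma exists_cofactor_chain (p : ℕ → K × K) (n : ℕ) :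
    ∃ D : MvPolynomial (Fin 3) K, D.IsHomogeneous n ∧
      ∏ i ∈ Finset.range (n + 2), linForm (chord (p (2 * i)) (p (2 * i + 1))) =
        (∏ i ∈ Finset.range (n + 1), linForm (chord (p (2 * i + 1)) (p (2 * i + 2)))) *
          linForm (chord (p (2 * n + 3)) (p 0)) + conicForm K * D := by
  induction n with
  | zero =>
    refine ⟨C (bracket (p 0) (p 2) * bracket (p 1) (p 3)), isHomogeneous_C _ _, ?_⟩
    rw [← linForm_chord_mul_sub]
    simp [Finset.prod_range_succ]
  | succ n ih =>
    obtain ⟨D, hD, h⟩ := ih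
    -- The diagonal from `p (2 * n + 3)` to `p 0` closes the shorter polygon. The quadrilateral with
    -- vertices `p 0`, `p (2 * n + 3)`, `p (2 * n + 4)`, `p (2 * n + 5)` is glued along it.
    refine ⟨D * linForm (chord (p (2 * n + 4)) (p (2 * n + 5))) +
      (∏ i ∈ Finset.range (n + 1), linForm (chord (p (2 * i + 1)) (p (2 * i + 2)))) *
        C (bracket (p 0) (p (2 * n + 4)) * bracket (p (2 * n + 3)) (p (2 * n + 5))), ?_, ?_⟩
    · refine (hD.mul (linForm_isHomogeneous _)).add ?_
      have h1 := IsHomogeneous.prod (Finset.range (n + 1))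
        (fun i => linForm (chord (p (2 * i + 1)) (p (2 * i + 2)))) (fun _ => 1)
        (fun i _ => linForm_isHomogeneous _)
      simpa using h1.mul (isHomogeneous_C (Fin 3)
        (bracket (p 0) (p (2 * n + 4)) * bracket (p (2 * n + 3)) (p (2 * n + 5))))
    · have key := linForm_chord_mul_sub (p 0) (p (2 * n + 3)) (p (2 * n + 4)) (p (2 * n + 5))
      rw [Finset.prod_range_succ, h, Finset.prod_range_succ _ (n + 1)]
      rw [chord_comm (p 0)] at key
      rw [show 2 * (n + 2) = 2 * n + 4 by ring, show 2 * (n + 1) + 1 = 2 * n + 3 by ring,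
        show 2 * (n + 1) + 2 = 2 * n + 4 by ring, show 2 * (n + 1) + 3 = 2 * n + 5 by ring,
        show 2 * n + 4 + 1 = 2 * n + 5 by ring]
      linear_combination
        (∏ i ∈ Finset.range (n + 1), linForm (chord (p (2 * i + 1)) (p (2 * i + 2)))) * key

lemma exists_cofactor (p : ℕ → K × K) {k : ℕ} (hk : 2 ≤ k) (hp : p (2 * k) = p 0) :
    ∃ D : MvPolynomial (Fin 3) K, D.IsHomogeneous (k - 2) ∧
      ∏ i : Fin k, linForm (chord (p (2 * i)) (p (2 * i + 1))) =
        ∏ i : Fin k, linForm (chord (p (2 * i + 1)) (p (2 * i + 2))) + conicForm K * D := by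
  obtain ⟨n, rfl⟩ := Nat.exists_eq_add_of_le' hk
  obtain ⟨D, hD, h⟩ := exists_cofactor_chain p n
  refine ⟨D, by simpa using hD, ?_⟩
  rw [Fin.prod_univ_eq_prod_range (fun i => linForm (chord (p (2 * i)) (p (2 * i + 1)))),
    Fin.prod_univ_eq_prod_range (fun i => linForm (chord (p (2 * i + 1)) (p (2 * i + 2)))), h,
    Finset.prod_range_succ _ (n + 1)]
  rw [show 2 * (n + 1) + 2 = 2 * (n + 2) by ring, hp]
  rfl

/-- The cofactor does not vanish at the vertices. -/
lemma eval_cofactor_ne_zero {ι κ : Type*} [Fintype ι] [Fintype κ] {r : ι → Fin 3 → K}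
    {b : κ → Fin 3 → K} {D : MvPolynomial (Fin 3) K}
    (h : ∏ i, linForm (r i) = ∏ j, linForm (b j) + conicForm K * D) {x y : Fin 3 → K}
    (hx : x 0 * x 2 = x 1 ^ 2) {i : ι} (hix : r i ⬝ᵥ x = 0) (hiy : r i ⬝ᵥ y = 0) {j : κ}
    (hjy : b j ⬝ᵥ y ≠ 0) (hjx : ∀ j', b j' ⬝ᵥ x = 0 ↔ j' = j) : eval x D ≠ 0 := by
  classical
  intro hD
  -- Restrict to `x + t y`, which runs along the red line through `x`. The red product vanishes
  -- identically, and the conic form and the one blue factor `b j` are divisible by `t`. If `D`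
  -- vanished at `x`, division by `t` and `t = 0` would leave a product of nonzero blue values equal
  -- to zero.
  let g : Fin 3 → Polynomial K := fun l => Polynomial.C (x l) + Polynomial.X * Polynomial.C (y l)
  have hg (a : Fin 3 → K) : aeval g (linForm a) =
      Polynomial.C (a ⬝ᵥ x) + Polynomial.X * Polynomial.C (a ⬝ᵥ y) := by
    simp [aeval_linForm, g, dotProduct, Fin.sum_univ_three]
    ring
  have hg0 : Polynomial.eval 0 (aeval g D) = eval x D := by
    have : (Polynomial.evalRingHom 0).comp (aeval g).toRingHom = eval x := by
      apply MvPolynomial.ringHom_ext <;> simp [g]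
    exact congr($this D)
  have hq : aeval g (conicForm K) = Polynomial.X * (Polynomial.C (x 0 * y 2 + y 0 * x 2 -
      (x 1 * y 1 + x 1 * y 1)) + Polynomial.X * Polynomial.C (y 0 * y 2 - y 1 ^ 2)) := by
    have : Polynomial.C (x 0) * Polynomial.C (x 2) = Polynomial.C (x 1) ^ 2 := by
      rw [← Polynomial.C_mul, hx, Polynomial.C_pow]
    simp [conicForm, g]
    linear_combination this
  have key := congr(aeval g $h)
  rw [map_prod, Finset.prod_eq_zero (Finset.mem_univ i) (by simp [hg, hix, hiy]), map_add, map_prod,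
    ← Finset.mul_prod_erase _ _ (Finset.mem_univ j), hg, (hjx j).mpr rfl, Polynomial.C_0, zero_add,
    map_mul, hq, mul_assoc, mul_assoc, ← mul_add] at key
  have key := congr(Polynomial.eval 0 $((mul_eq_zero.mp key.symm).resolve_left Polynomial.X_ne_zero))
  simp only [Polynomial.eval_add, Polynomial.eval_mul, hg0, hD, mul_zero, add_zero, hg,
    Polynomial.eval_prod, Polynomial.eval_C, Polynomial.eval_X, zero_mul, Polynomial.eval_zero]
    at key
  refine mul_ne_zero hjy (Finset.prod_ne_zero_iff.mpr fun j' hj' => ?_) key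
  exact fun h0 => (Finset.mem_erase.mp hj').1 ((hjx j').mp h0)

end Cofactor

/-! ### Zeros of binary forms. -/

section Binary

variable {K : Type*} [Field K]

/-- A binary form that vanishes at a point is divisible by the linear form of the point. -/
lemma linForm_dvd_of_eval_eq_zero {n : ℕ} {c : MvPolynomial (Fin 2) K} (hc : c.IsHomogeneous n)
    {s : Fin 2 → K} (hs : s ≠ 0) (h : eval s c = 0) : linForm ![s 1, -s 0] ∣ c := by
  rw [← Ideal.mem_span_singleton, ← Ideal.Quotient.eq_zero_iff_mem]
  set I := Ideal.span {linForm ![s 1, -s 0]}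
  let A := MvPolynomial (Fin 2) K ⧸ I
  let π : MvPolynomial (Fin 2) K →ₐ[K] A := Ideal.Quotient.mkₐ K I
  have hrel : algebraMap K A (s 1) * π (X 0) = algebraMap K A (s 0) * π (X 1) := by
    have : π (linForm ![s 1, -s 0]) = 0 :=
      Ideal.Quotient.eq_zero_iff_mem.mpr (Ideal.mem_span_singleton_self _)
    have hC (a : K) : π (C a) = algebraMap K A a := π.commutes a
    simp only [linForm, Fin.sum_univ_two, map_add, map_mul, hC] at this
    simp only [cons_val_zero, cons_val_one, map_neg] at this
    linear_combination this
  -- Modulo the linear form the variables are a common multiple `u` of the coordinates of `s`, so by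
  -- homogeneity `c` becomes `u ^ n` times its value at `s`.
  obtain ⟨u, hu⟩ : ∃ u : A, ∀ i, π (X i) = u * algebraMap K A (s i) := by
    by_cases h0 : s 0 = 0
    · have h1 : s 1 ≠ 0 := fun h1 => hs (by ext i; fin_cases i <;> simpa)
      have hinv : algebraMap K A (s 1) * algebraMap K A (s 1)⁻¹ = 1 := by
        rw [← map_mul, mul_inv_cancel₀ h1, map_one]
      refine ⟨algebraMap K A (s 1)⁻¹ * π (X 1), Fin.forall_fin_two.mpr ⟨?_, ?_⟩⟩
      · linear_combination algebraMap K A (s 1)⁻¹ * hrel - π (X 0) * hinv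
      · linear_combination -π (X 1) * hinv
    · have hinv : algebraMap K A (s 0) * algebraMap K A (s 0)⁻¹ = 1 := by
        rw [← map_mul, mul_inv_cancel₀ h0, map_one]
      refine ⟨algebraMap K A (s 0)⁻¹ * π (X 0), Fin.forall_fin_two.mpr ⟨?_, ?_⟩⟩
      · linear_combination -π (X 0) * hinv
      · linear_combination -algebraMap K A (s 0)⁻¹ * hrel - π (X 1) * hinv
  have hπ : π c = aeval (fun i => u * algebraMap K A (s i)) c := by
    have : π = aeval (fun i => u * algebraMap K A (s i)) := algHom_ext fun i => by simp [hu]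
    exact congr($this c)
  change π c = 0
  rw [hπ, aeval_def, eval₂_eq']
  have hterm : ∀ d ∈ c.support, algebraMap K A (coeff d c) *
      ∏ i, (u * algebraMap K A (s i)) ^ d i =
      u ^ n * algebraMap K A (coeff d c * ∏ i, s i ^ d i) := by
    intro d hd
    have hdeg : d 0 + d 1 = n := by
      have : d.degree = n := by
        rw [Finsupp.degree_eq_weight_one]
        exact hc (mem_support_iff.mp hd)
      simpa [Finsupp.degree_eq_sum] using this
    simp only [Fin.prod_univ_two, map_mul, map_pow, ← hdeg]
    ring
  rw [Finset.sum_congr rfl hterm, ← Finset.mul_sum, ← map_sum, ← eval_eq', h, map_zero, mul_zero]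

/-- A binary form with more zeros than its degree vanishes. -/
lemma binaryForm_eq_zero {n : ℕ} {c : MvPolynomial (Fin 2) K} (hc : c.IsHomogeneous n) {ι : Type*}
    {T : Finset ι} {s : ι → Fin 2 → K} (hT : n < T.card) (hs0 : ∀ i ∈ T, s i ≠ 0)
    (hs : ∀ i ∈ T, ∀ j ∈ T, i ≠ j → s i 1 * s j 0 ≠ s i 0 * s j 1)
    (h : ∀ i ∈ T, eval (s i) c = 0) : c = 0 := by
  by_contra hc0
  have hne (i) (hi : i ∈ T) : ![s i 1, -s i 0] ≠ 0 := fun h0 => hs0 i hi (by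
    have h1 := congr_fun h0 0
    have h2 := congr_fun h0 1
    ext l
    fin_cases l
    · simpa using h2
    · simpa using h1)
  have hdvd : ∏ i ∈ T, linForm ![s i 1, -s i 0] ∣ c := by
    refine Finset.prod_dvd_of_isRelPrime (fun i hi j hj hij => ?_)
      fun i hi => linForm_dvd_of_eval_eq_zero hc (hs0 i hi) (h i hi)
    rw [Function.onFun, (linForm_irreducible (hne i hi)).isRelPrime_iff_not_dvd]
    rintro ⟨q, hq⟩
    have := congr(eval (s i) $hq)
    simp only [map_mul, eval_linForm, dotProduct, Fin.sum_univ_two, cons_val_zero, cons_val_one]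
      at this
    exact hs i hi j hj hij (by linear_combination -this)
  obtain ⟨q, hq⟩ := hdvd
  have hq0 : q ≠ 0 := by
    rintro rfl
    exact hc0 (by rw [hq, mul_zero])
  have hprod : ∏ i ∈ T, linForm ![s i 1, -s i 0] ≠ 0 :=
    Finset.prod_ne_zero_iff.mpr fun i hi => linForm_ne_zero (hne i hi)
  have hdeg := congr(totalDegree $hq)
  have hTdeg := (IsHomogeneous.prod T (fun i => linForm ![s i 1, -s i 0]) (fun _ => 1)
    fun i _ => linForm_isHomogeneous _).totalDegree hprod
  rw [totalDegree_mul_of_isDomain hprod hq0, hc.totalDegree hc0, hTdeg] at hdeg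
  simp at hdeg
  omega

end Binary

/-! ### Unique factorization of products of linear forms. -/

section Factorization

variable {K : Type*} [Field K] {σ ι κ : Type*} [Fintype σ] [Fintype ι] [Fintype κ]

lemma dotProduct_eq_zero_of_linForm_dvd {a b : σ → K} (h : linForm a ∣ linForm b) {s : σ → K}
    (hs : a ⬝ᵥ s = 0) : b ⬝ᵥ s = 0 := by
  obtain ⟨q, hq⟩ := h
  rw [← eval_linForm, hq, map_mul, eval_linForm, hs, zero_mul]

lemma exists_linForm_dvd {a : ι → σ → K} {b : κ → σ → K} (ha : ∀ i, a i ≠ 0)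
    (h : ∏ i, linForm (a i) = ∏ j, linForm (b j)) (i : ι) :
    ∃ j, linForm (a i) ∣ linForm (b j) := by
  obtain ⟨j, -, hj⟩ := ((linForm_irreducible (ha i)).prime.dvd_finsetProd_iff _).mp
    (h ▸ Finset.dvd_prod_of_mem (fun i => linForm (a i)) (Finset.mem_univ i))
  exact ⟨j, hj⟩

/-- Cancelling a matched pair before matching the second factor keeps the partners distinct, even
when `a i` and `a i'` are proportional. -/
lemma exists_two_linForm_dvd {a : ι → σ → K} {b : κ → σ → K} (ha : ∀ i, a i ≠ 0)
    (hb : ∀ j, b j ≠ 0) (h : ∏ i, linForm (a i) = ∏ j, linForm (b j)) {i i' : ι} (hi : i ≠ i') :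
    ∃ j j', j ≠ j' ∧ linForm (a i) ∣ linForm (b j) ∧ linForm (a i') ∣ linForm (b j') := by
  classical
  obtain ⟨j, hj⟩ := exists_linForm_dvd ha h i
  have hass := (linForm_irreducible (ha i)).associated_of_dvd (linForm_irreducible (hb j)) hj
  rw [← Finset.mul_prod_erase _ _ (Finset.mem_univ i),
    ← Finset.mul_prod_erase _ _ (Finset.mem_univ j)] at h
  have hrest := Associated.of_mul_left (Associated.of_eq h) hass (linForm_ne_zero (ha i))
  have hdvd := (Finset.dvd_prod_of_mem (fun i => linForm (a i))
    (Finset.mem_erase.mpr ⟨hi.symm, Finset.mem_univ i'⟩)).trans hrest.dvd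
  obtain ⟨j', hj', hdvd'⟩ := ((linForm_irreducible (ha i')).prime.dvd_finsetProd_iff _).mp hdvd
  exact ⟨j, j', (Finset.mem_erase.mp hj').1.symm, hj, hdvd'⟩

end Factorization

/-! ### Incidences of the polygon and the count of crossing points. -/

section Polygon

/-- The bound `2 * k` is included because the last blue edge ends at index `2 * k`, which is vertex
`0`. -/
lemma natCast_eq_natCast_iff_of_le {k a b : ℕ} (ha : a ≤ 2 * k) (hb : b ≤ 2 * k) :
    (a : ZMod (2 * k)) = b ↔ a = b ∨ a = 0 ∧ b = 2 * k ∨ a = 2 * k ∧ b = 0 := by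
  rw [ZMod.natCast_eq_natCast_iff']
  rcases ha.lt_or_eq with ha' | rfl <;> rcases hb.lt_or_eq with hb' | rfl
  · rw [Nat.mod_eq_of_lt ha', Nat.mod_eq_of_lt hb']
    omega
  · rw [Nat.mod_eq_of_lt ha', Nat.mod_self]
    omega
  · rw [Nat.mod_eq_of_lt hb', Nat.mod_self]
    omega
  · simp

variable {K : Type*} [Field K] {k : ℕ} {v : ZMod (2 * k) → ProjPlane K}
  {N : (Fin 3 → K) ≃ₗ[K] (Fin 3 → K)} {p : ZMod (2 * k) → K × K} {c : ZMod (2 * k) → K}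

lemma chord_dotProduct_vertex_eq_zero_iff (hv : Function.Injective v)
    (hN : ∀ m, N (v m).rep = c m • veronese (p m)) (a b n : ZMod (2 * k)) :
    chord (p a) (p b) ⬝ᵥ N (v n).rep = 0 ↔ n = a ∨ n = b := by
  have hc : c n ≠ 0 := by
    intro h0
    apply (map_ne_zero_iff N N.injective).mpr (v n).rep_nonzero
    rw [hN, h0, zero_smul]
  have hb (a : ZMod (2 * k)) : bracket (p a) (p n) = 0 ↔ n = a := by
    refine ⟨fun h => ?_, by rintro rfl; simp⟩
    by_contra hne
    exact bracket_ne_zero (hv.ne (Ne.symm hne)) (hN a) (hN n) h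
  rw [hN, dotProduct_smul, smul_eq_mul, chord_dotProduct_veronese, mul_eq_zero, mul_eq_zero, hb, hb]
  simp [hc]

lemma mem_lineThrough_iff_dotProduct {P Q : ProjPlane K} (hPQ : P ≠ Q) {a : Fin 3 → K}
    (ha : a ≠ 0) (hP : a ⬝ᵥ N P.rep = 0) (hQ : a ⬝ᵥ N Q.rep = 0) (x : ProjPlane K) :
    x ∈ lineThrough P Q ↔ a ⬝ᵥ N x.rep = 0 := by
  let f : Module.Dual K (Fin 3 → K) := (dotProductBilin K K a).comp N.toLinearMap
  have hf : f ≠ 0 := by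
    intro h0
    obtain ⟨x, hx⟩ := exists_dotProduct_ne_zero ha
    apply hx
    simpa [f] using congr($h0 (N.symm x))
  exact mem_lineThrough_iff hPQ hf hP hQ x

lemma mem_lineThrough_vertices_iff (hv : Function.Injective v)
    (hN : ∀ m, N (v m).rep = c m • veronese (p m)) {a b : ZMod (2 * k)} (hab : a ≠ b)
    (x : ProjPlane K) :
    x ∈ lineThrough (v a) (v b) ↔ chord (p a) (p b) ⬝ᵥ N x.rep = 0 :=
  mem_lineThrough_iff_dotProduct (hv.ne hab) (chord_ne_zero (hv.ne hab) (hN a) (hN b))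
    ((chord_dotProduct_vertex_eq_zero_iff hv hN a b a).mpr (Or.inl rfl))
    ((chord_dotProduct_vertex_eq_zero_iff hv hN a b b).mpr (Or.inr rfl)) x

lemma mem_redLine_iff (hk : 2 ≤ k) (hv : Function.Injective v)
    (hN : ∀ m, N (v m).rep = c m • veronese (p m)) (i : Fin k) (x : ProjPlane K) :
    x ∈ redLine v i ↔ chord (p (2 * i.val : ℕ)) (p (2 * i.val + 1 : ℕ)) ⬝ᵥ N x.rep = 0 :=
  mem_lineThrough_vertices_iff hv hN (by
    rw [ne_eq, natCast_eq_natCast_iff_of_le] <;> omega) x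

lemma mem_blueLine_iff (hv : Function.Injective v)
    (hN : ∀ m, N (v m).rep = c m • veronese (p m)) (i : Fin k) (x : ProjPlane K) :
    x ∈ blueLine v i ↔ chord (p (2 * i.val + 1 : ℕ)) (p (2 * i.val + 2 : ℕ)) ⬝ᵥ N x.rep = 0 :=
  mem_lineThrough_vertices_iff hv hN (by
    rw [ne_eq, natCast_eq_natCast_iff_of_le] <;> omega) x

/-- The conic meets the line joining two vertices in these vertices only. -/
lemma mem_range_of_mem_lineThrough (hN : ∀ m, N (v m).rep = c m • veronese (p m))
    {a b : ZMod (2 * k)} {x : ProjPlane K} (h : chord (p a) (p b) ⬝ᵥ N x.rep = 0)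
    (hx : N x.rep 0 * N x.rep 2 = N x.rep 1 ^ 2) : x ∈ Set.range v := by
  obtain ⟨d, q, hq⟩ := exists_smul_veronese hx
  have hd : d ≠ 0 := by
    rintro rfl
    apply (map_ne_zero_iff N N.injective).mpr x.rep_nonzero
    rw [hq, zero_smul]
  rw [hq, dotProduct_smul, smul_eq_mul, chord_dotProduct_veronese] at h
  by_contra hv
  have hne (m : ZMod (2 * k)) : v m ≠ x := fun h => hv ⟨m, h⟩
  exact mul_ne_zero hd (mul_ne_zero (bracket_ne_zero (hne a) (hN a) hq)
    (bracket_ne_zero (hne b) (hN b) hq)) h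

lemma vertex_mem_redLine_iff (hk : 2 ≤ k) (hv : Function.Injective v)
    (hN : ∀ m, N (v m).rep = c m • veronese (p m)) (i : Fin k) (n : ZMod (2 * k)) :
    v n ∈ redLine v i ↔ n = (2 * i.val : ℕ) ∨ n = (2 * i.val + 1 : ℕ) := by
  rw [mem_redLine_iff hk hv hN, chord_dotProduct_vertex_eq_zero_iff hv hN]

lemma vertex_mem_blueLine_iff (hv : Function.Injective v)
    (hN : ∀ m, N (v m).rep = c m • veronese (p m)) (i : Fin k) (n : ZMod (2 * k)) :
    v n ∈ blueLine v i ↔ n = (2 * i.val + 1 : ℕ) ∨ n = (2 * i.val + 2 : ℕ) := by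
  rw [mem_blueLine_iff hv hN, chord_dotProduct_vertex_eq_zero_iff hv hN]

/-- A red line and a blue line have at most one point in common. -/
lemma eq_of_mem_redLine_of_mem_blueLine (hk : 2 ≤ k) (hv : Function.Injective v)
    (hN : ∀ m, N (v m).rep = c m • veronese (p m)) {i j : Fin k} {x y : ProjPlane K}
    (hxr : x ∈ redLine v i) (hxb : x ∈ blueLine v j) (hyr : y ∈ redLine v i)
    (hyb : y ∈ blueLine v j) : x = y := by
  by_contra hxy
  have hne {a b : ℕ} (h : (a : ZMod (2 * k)) ≠ b) : chord (p a) (p b) ≠ 0 :=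
    chord_ne_zero (hv.ne h) (hN a) (hN b)
  -- Two common points would make the lines equal, so both ends of the blue edge would be ends of
  -- the red edge, which is impossible for `2 ≤ k`.
  have hsub (n : ZMod (2 * k)) : v n ∈ blueLine v j → v n ∈ redLine v i := by
    rw [mem_redLine_iff hk hv hN] at hxr hyr ⊢
    rw [mem_blueLine_iff hv hN] at hxb hyb ⊢
    rw [← mem_lineThrough_iff_dotProduct hxy _ hxr hyr,
      ← mem_lineThrough_iff_dotProduct hxy _ hxb hyb]
    · exact id
    · apply hne
      rw [ne_eq, natCast_eq_natCast_iff_of_le] <;> omega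
    · apply hne
      rw [ne_eq, natCast_eq_natCast_iff_of_le] <;> omega
  simp only [vertex_mem_redLine_iff hk hv hN, vertex_mem_blueLine_iff hv hN] at hsub
  have h1 := hsub _ (Or.inl rfl)
  have h2 := hsub _ (Or.inr rfl)
  rw [natCast_eq_natCast_iff_of_le, natCast_eq_natCast_iff_of_le] at h1 h2 <;> omega

/-- Adjacent edges have their common vertex as only common point. The red neighbours of the blue
edge `j` are `j` and its cyclic successor `finRotate k j`. -/
lemma not_adjacent_of_mem (hk : 2 ≤ k) (hv : Function.Injective v)
    (hN : ∀ m, N (v m).rep = c m • veronese (p m)) {i j : Fin k} {x : ProjPlane K}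
    (hxr : x ∈ redLine v i) (hxb : x ∈ blueLine v j) (hx : x ∉ Set.range v) :
    i ≠ j ∧ i ≠ finRotate k j := by
  have h (n : ZMod (2 * k)) : ¬ (v n ∈ redLine v i ∧ v n ∈ blueLine v j) := fun h =>
    hx ⟨n, (eq_of_mem_redLine_of_mem_blueLine hk hv hN hxr hxb h.1 h.2).symm⟩
  simp only [vertex_mem_redLine_iff hk hv hN, vertex_mem_blueLine_iff hv hN] at h
  constructor
  · rintro rfl
    exact h _ ⟨Or.inr rfl, Or.inl rfl⟩
  · intro hij
    refine h _ ⟨Or.inl rfl, Or.inr ?_⟩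
    obtain ⟨n, rfl⟩ := Nat.exists_eq_add_of_le' (show 1 ≤ k by omega)
    rw [natCast_eq_natCast_iff_of_le (by omega) (by omega), hij, coe_finRotate]
    split_ifs with hl
    · have := congr_arg Fin.val hl
      simp at this
      omega
    · omega

/-- There are at most `k² - 2k` crossing points, and fewer if some crossing point lies on two lines
of both colors. -/
lemma ncard_crossingPoints_lt (hk : 2 ≤ k) (hv : Function.Injective v)
    (hN : ∀ m, N (v m).rep = c m • veronese (p m)) {x : ProjPlane K}
    (hx : x ∈ crossingPoints v) {i i' j : Fin k} (hi : i ≠ i') (hxi : x ∈ redLine v i)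
    (hxi' : x ∈ redLine v i') (hxj : x ∈ blueLine v j) :
    (crossingPoints v).ncard < k ^ 2 - 2 * k := by
  classical
  let A : Finset (Fin k × Fin k) := Finset.univ.filter fun q =>
    ∃ y ∈ crossingPoints v, y ∈ redLine v q.1 ∧ y ∈ blueLine v q.2
  have hA : ∀ q ∈ A, ∃ y ∈ crossingPoints v, y ∈ redLine v q.1 ∧ y ∈ blueLine v q.2 :=
    fun q hq => (Finset.mem_filter.mp hq).2
  choose! f hf using hA
  have hfeq {i j : Fin k} {y : ProjPlane K} (hy : y ∈ crossingPoints v) (hi : y ∈ redLine v i)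
      (hj : y ∈ blueLine v j) : (i, j) ∈ A ∧ f (i, j) = y := by
    have hmem : (i, j) ∈ A := Finset.mem_filter.mpr ⟨Finset.mem_univ _, y, hy, hi, hj⟩
    exact ⟨hmem, eq_of_mem_redLine_of_mem_blueLine hk hv hN (hf _ hmem).2.1 (hf _ hmem).2.2 hi hj⟩
  -- The pair `(i', j)` can be dropped, since `(i, j)` already yields `x`.
  have hΓ : crossingPoints v ⊆ ((A.erase (i', j)).image f : Finset (ProjPlane K)) := by
    intro y hy
    obtain ⟨⟨a, ha⟩, ⟨b, hb⟩, -⟩ := id hy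
    obtain ⟨hmem, hfy⟩ := hfeq hy ha hb
    rw [Finset.mem_coe, Finset.mem_image]
    by_cases h : (a, b) = (i', j)
    · have hyx : y = x := by
        rw [← hfy, h]
        exact (hfeq hx hxi' hxj).2
      obtain ⟨hmem', hfx⟩ := hfeq hx hxi hxj
      exact ⟨(i, j), Finset.mem_erase.mpr ⟨by simp [hi], hmem'⟩, hfx.trans hyx.symm⟩
    · exact ⟨(a, b), Finset.mem_erase.mpr ⟨h, hmem⟩, hfy⟩
  have hcard : (crossingPoints v).ncard ≤ (A.erase (i', j)).card := by
    refine (Set.ncard_le_ncard hΓ (Finset.finite_toSet _)).trans ?_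
    rw [Set.ncard_coe_finset]
    exact Finset.card_image_le
  have hlt : (A.erase (i', j)).card < A.card :=
    Finset.card_erase_lt_of_mem (hfeq hx hxi' hxj).1
  refine hcard.trans_lt (hlt.trans_le ?_)
  -- The `2 k` adjacent pairs, `k` of each kind, are not in `A`, so `A` has at most `k² - 2k`
  -- elements.
  let d₁ : Fin k ↪ Fin k × Fin k := ⟨fun j => (j, j), fun a b h => (Prod.ext_iff.mp h).2⟩
  let d₂ : Fin k ↪ Fin k × Fin k := ⟨fun j => (finRotate k j, j), fun a b h => (Prod.ext_iff.mp h).2⟩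
  have hadj : ∀ q ∈ A, q.1 ≠ q.2 ∧ q.1 ≠ finRotate k q.2 := by
    intro q hq
    obtain ⟨y, hy, hy1, hy2⟩ := (Finset.mem_filter.mp hq).2
    exact not_adjacent_of_mem hk hv hN hy1 hy2 hy.2.2
  have hrot (j : Fin k) : finRotate k j ≠ j := by
    obtain ⟨n, rfl⟩ := Nat.exists_eq_add_of_le' (show 1 ≤ k by omega)
    intro h
    have h := congr_arg Fin.val h
    rw [coe_finRotate] at h
    split_ifs at h with hl
    · have := congr_arg Fin.val hl
      simp at this
      omega
    · omega
  have hdisj : Disjoint (Finset.univ.map d₁) (Finset.univ.map d₂) := by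
    rw [Finset.disjoint_left]
    simp only [Finset.mem_map, Finset.mem_univ, true_and, forall_exists_index]
    rintro _ a rfl ⟨b, hb⟩
    obtain ⟨h1, h2⟩ := Prod.ext_iff.mp hb
    exact hrot b (h1.trans h2.symm)
  have hdisjA : Disjoint A (Finset.univ.map d₁ ∪ Finset.univ.map d₂) := by
    rw [Finset.disjoint_left]
    intro q hq hq'
    simp only [Finset.mem_union, Finset.mem_map, Finset.mem_univ, true_and] at hq'
    rcases hq' with ⟨a, rfl⟩ | ⟨a, rfl⟩
    · exact (hadj _ hq).1 rfl
    · exact (hadj _ hq).2 rfl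
  have htot := Finset.card_le_univ (A ∪ (Finset.univ.map d₁ ∪ Finset.univ.map d₂))
  rw [Finset.card_union_of_disjoint hdisjA, Finset.card_union_of_disjoint hdisj] at htot
  simp only [Finset.card_map, Finset.card_univ, Fintype.card_fin, Fintype.card_prod, ← sq] at htot
  omega

end Polygon

/-! ### Restriction of ternary forms to a line. -/

section Restriction

variable {K : Type*} [Field K]

/-- Restriction of ternary forms to the line spanned by two vectors. -/
noncomputable def restrictToLine (e₀ e₁ : Fin 3 → K) :
    MvPolynomial (Fin 3) K →ₐ[K] MvPolynomial (Fin 2) K :=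
  aeval fun l => linForm ![e₀ l, e₁ l]

lemma restrictToLine_linForm (e₀ e₁ a : Fin 3 → K) :
    restrictToLine e₀ e₁ (linForm a) = linForm ![a ⬝ᵥ e₀, a ⬝ᵥ e₁] := by
  rw [restrictToLine, aeval_linForm]
  simp [linForm, dotProduct, Fin.sum_univ_three, algebraMap_eq]
  ring

lemma eval_restrictToLine (e₀ e₁ : Fin 3 → K) (s : Fin 2 → K) (D : MvPolynomial (Fin 3) K) :
    eval s (restrictToLine e₀ e₁ D) = eval (s 0 • e₀ + s 1 • e₁) D := by
  have : (eval s).comp (restrictToLine e₀ e₁).toRingHom = eval (s 0 • e₀ + s 1 • e₁) := by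
    apply MvPolynomial.ringHom_ext
    · simp
    · intro i
      simp [restrictToLine, eval_linForm, dotProduct, Fin.sum_univ_two, mul_comm]
  exact congr($this D)

lemma MvPolynomial.IsHomogeneous.restrictToLine {n : ℕ} {D : MvPolynomial (Fin 3) K}
    (hD : D.IsHomogeneous n) (e₀ e₁ : Fin 3 → K) : (restrictToLine e₀ e₁ D).IsHomogeneous n := by
  have := hD.aeval (fun l => linForm ![e₀ l, e₁ l]) fun l => linForm_isHomogeneous _
  rwa [one_mul] at this

lemma dotProduct_line_combination (a e₀ e₁ : Fin 3 → K) (s : Fin 2 → K) :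
    a ⬝ᵥ (s 0 • e₀ + s 1 • e₁) = ![a ⬝ᵥ e₀, a ⬝ᵥ e₁] ⬝ᵥ s := by
  rw [dotProduct_add, dotProduct_smul, dotProduct_smul]
  generalize a ⬝ᵥ e₀ = u, a ⬝ᵥ e₁ = w
  simp [dotProduct, Fin.sum_univ_two, mul_comm]

/-- A basis of a line, in given coordinates. -/
lemma exists_line_basis {a : Fin 3 → K} (ha : a ≠ 0) (N : (Fin 3 → K) ≃ₗ[K] (Fin 3 → K)) :
    ∃ e₀ e₁ : Fin 3 → K, LinearIndependent K ![e₀, e₁] ∧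
      ∀ x, a ⬝ᵥ x = 0 ↔ ∃ s : Fin 2 → K, N x = s 0 • e₀ + s 1 • e₁ := by
  let f : Module.Dual K (Fin 3 → K) := dotProductBilin K K a
  have hf : f ≠ 0 := by
    intro h0
    obtain ⟨x, hx⟩ := exists_dotProduct_ne_zero ha
    exact hx congr($h0 x)
  have hrank : Module.finrank K (LinearMap.ker f) = 2 := by
    have := Module.Dual.finrank_ker_add_one_of_ne_zero hf
    simp at this
    omega
  let b := Module.finBasisOfFinrankEq K (LinearMap.ker f) hrank
  refine ⟨N (b 0), N (b 1), ?_, fun x => ⟨fun hx => ?_, ?_⟩⟩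
  · apply linearIndependent_pair_map
    have := b.linearIndependent.map' (LinearMap.ker f).subtype (Submodule.ker_subtype _)
    have hb : ![((b 0 : LinearMap.ker f) : Fin 3 → K), b 1] = (LinearMap.ker f).subtype ∘ b := by
      ext1 i
      fin_cases i <;> rfl
    rwa [hb]
  · let y : LinearMap.ker f := ⟨x, hx⟩
    refine ⟨b.equivFun y, ?_⟩
    have := congr(N ($(b.sum_equivFun y) : Fin 3 → K))
    rw [← this, Fin.sum_univ_two]
    simp
  · rintro ⟨s, hs⟩
    have hx : x = s 0 • (b 0 : Fin 3 → K) + s 1 • (b 1 : Fin 3 → K) := by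
      apply N.injective
      rw [hs, map_add, map_smul, map_smul]
    rw [hx, dotProduct_add, dotProduct_smul, dotProduct_smul]
    have h0 : a ⬝ᵥ (b 0 : Fin 3 → K) = 0 := (b 0).2
    have h1 : a ⬝ᵥ (b 1 : Fin 3 → K) = 0 := (b 1).2
    rw [h0, h1, smul_zero, smul_zero, add_zero]

/-- A linear form that vanishes on a line vanishes on no further point, unless it is zero. -/
lemma exists_combination_of_dotProduct_eq_zero {e₀ e₁ a x : Fin 3 → K}
    (he : LinearIndependent K ![e₀, e₁]) (ha : a ≠ 0) (h₀ : a ⬝ᵥ e₀ = 0) (h₁ : a ⬝ᵥ e₁ = 0)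
    (hx : a ⬝ᵥ x = 0) : ∃ s : Fin 2 → K, x = s 0 • e₀ + s 1 • e₁ := by
  obtain ⟨d, hd⟩ := exists_dotProduct_ne_zero ha
  obtain ⟨b, hb⟩ := exists_dotProduct_ne_zero (crossProduct_ne_zero_iff_linearIndependent.mpr he)
  have hd' : crossProduct e₀ e₁ ⬝ᵥ x = 0 := by
    have h1 := congr(a ⬝ᵥ $(cramer_crossProduct e₀ e₁ b x))
    have h2 := congr(a ⬝ᵥ $(cramer_crossProduct e₀ e₁ b d))
    simp only [dotProduct_add, dotProduct_smul, h₀, h₁, hx, smul_eq_mul, mul_zero, zero_add]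
      at h1 h2
    refine (mul_eq_zero.mp h1.symm).resolve_right fun h => mul_ne_zero hb hd ?_
    rw [h2, h, mul_zero]
  have := cramer_crossProduct e₀ e₁ b x
  rw [hd', zero_smul, add_zero] at this
  refine ⟨![(crossProduct e₀ e₁ ⬝ᵥ b)⁻¹ * (crossProduct e₁ b ⬝ᵥ x),
    (crossProduct e₀ e₁ ⬝ᵥ b)⁻¹ * (crossProduct b e₀ ⬝ᵥ x)], ?_⟩
  rw [cons_val_zero, cons_val_one, cons_val_zero, mul_smul, mul_smul, ← smul_add, ← this,
    inv_smul_smul₀ hb]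

end Restriction

/-! ### The green line. -/

section Main

variable {K : Type*} [Field K] {k : ℕ} {v : ZMod (2 * k) → ProjPlane K}
  {N : (Fin 3 → K) ≃ₗ[K] (Fin 3 → K)} {p : ZMod (2 * k) → K × K} {c : ZMod (2 * k) → K}

lemma eval_cofactor_vertex_ne_zero (hk : 2 ≤ k) (hv : Function.Injective v)
    (hN : ∀ m, N (v m).rep = c m • veronese (p m)) {D : MvPolynomial (Fin 3) K}
    (hD : ∏ i : Fin k, linForm (chord (p (2 * i.val : ℕ)) (p (2 * i.val + 1 : ℕ))) =
      ∏ i : Fin k, linForm (chord (p (2 * i.val + 1 : ℕ)) (p (2 * i.val + 2 : ℕ))) +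
        conicForm K * D) (n : ZMod (2 * k)) : eval (N (v n).rep) D ≠ 0 := by
  have : NeZero (2 * k) := ⟨by omega⟩
  obtain ⟨m, hm, rfl⟩ : ∃ m : ℕ, m < 2 * k ∧ (m : ZMod (2 * k)) = n :=
    ⟨n.val, n.val_lt, ZMod.natCast_zmod_val n⟩
  have hz := chord_dotProduct_vertex_eq_zero_iff hv hN
  have hq : N (v m).rep 0 * N (v m).rep 2 = N (v m).rep 1 ^ 2 := by
    rw [hN]
    simp [veronese]
    ring
  -- Here `m'` is the other end of the red edge `i` at `m`, and `j` is the blue edge at `m`; at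
  -- vertex `0` this is the last one, `k - 1`.
  obtain ⟨m', i, j, hm', hi, hj⟩ : ∃ (m' : ℕ) (i j : Fin k), m' < 2 * k ∧
      (m = 2 * i.val ∧ m' = 2 * i.val + 1 ∨ m = 2 * i.val + 1 ∧ m' = 2 * i.val) ∧
      (m = 2 * j.val + 1 ∨ m = 2 * j.val + 2 ∨ m = 0 ∧ j.val + 1 = k) := by
    obtain ⟨i, rfl | rfl⟩ := Nat.even_or_odd' m
    · rcases i with _ | i
      · exact ⟨1, ⟨0, by omega⟩, ⟨k - 1, by omega⟩, by omega, by simp,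
          Or.inr (Or.inr ⟨rfl, by simp only; omega⟩)⟩
      · exact ⟨2 * (i + 1) + 1, ⟨i + 1, by omega⟩, ⟨i, by omega⟩, by omega, by simp,
          Or.inr (Or.inl (by simp only; omega))⟩
    · exact ⟨2 * i, ⟨i, by omega⟩, ⟨i, by omega⟩, by omega, by simp, Or.inl rfl⟩
  refine eval_cofactor_ne_zero hD (y := N (v m').rep) (i := i) (j := j) hq ?_ ?_ ?_ fun j' => ?_
  · rw [hz, natCast_eq_natCast_iff_of_le, natCast_eq_natCast_iff_of_le] <;> omega
  · rw [hz, natCast_eq_natCast_iff_of_le, natCast_eq_natCast_iff_of_le] <;> omega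
  · rw [ne_eq, hz, natCast_eq_natCast_iff_of_le, natCast_eq_natCast_iff_of_le] <;> omega
  · rw [hz, natCast_eq_natCast_iff_of_le, natCast_eq_natCast_iff_of_le, Fin.ext_iff] <;> omega

/-- A line that contains `k - 1` crossing points contains no vertex, and the products of the
equations of the red and the blue lines agree on it. -/
lemma prod_restrictToLine_eq (hk : 2 ≤ k) (hv : Function.Injective v)
    (hN : ∀ m, N (v m).rep = c m • veronese (p m)) {e₀ e₁ : Fin 3 → K}
    {S : Finset (ProjPlane K)} (hcard : S.card = k - 1) (hS : ∀ P ∈ S, P ∈ crossingPoints v)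
    (hSG : ∀ P ∈ S, ∃ s : Fin 2 → K, N P.rep = s 0 • e₀ + s 1 • e₁) :
    (∀ m, ¬ ∃ s : Fin 2 → K, N (v m).rep = s 0 • e₀ + s 1 • e₁) ∧
    ∏ i : Fin k, restrictToLine e₀ e₁
        (linForm (chord (p (2 * i.val : ℕ)) (p (2 * i.val + 1 : ℕ)))) =
      ∏ i : Fin k, restrictToLine e₀ e₁
        (linForm (chord (p (2 * i.val + 1 : ℕ)) (p (2 * i.val + 2 : ℕ)))) := by
  obtain ⟨D, hDhom, hD⟩ := exists_cofactor (fun m : ℕ => p m) hk (by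
    rw [Nat.cast_zero, ZMod.natCast_self])
  have hDS : ∀ P ∈ S, eval (N P.rep) D = 0 := by
    intro P hP
    obtain ⟨⟨i, hi⟩, ⟨j, hj⟩, hPv⟩ := hS P hP
    rw [mem_redLine_iff hk hv hN] at hi
    rw [mem_blueLine_iff hv hN] at hj
    have h := congr(eval (N P.rep) $hD)
    rw [map_prod, Finset.prod_eq_zero (Finset.mem_univ i) (by rw [eval_linForm, hi]), map_add,
      map_prod, Finset.prod_eq_zero (Finset.mem_univ j) (by rw [eval_linForm, hj]), zero_add,
      map_mul] at h
    -- The conic form is nonzero at `P`, because a red line meets the conic in vertices only.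
    refine (mul_eq_zero.mp h.symm).resolve_left fun h0 => hPv ?_
    apply mem_range_of_mem_lineThrough hN hi
    simpa [conicForm, sub_eq_zero] using h0
  choose! s hs using hSG
  have hD0 : restrictToLine e₀ e₁ D = 0 := by
    refine binaryForm_eq_zero (hDhom.restrictToLine e₀ e₁) (T := S) (s := s) (by omega) ?_ ?_ ?_
    · intro P hP h0
      apply (map_ne_zero_iff N N.injective).mpr P.rep_nonzero
      rw [hs P hP, h0]
      simp
    · intro P hP Q hQ hPQ h0
      have hli := linearIndependent_pair_map N (linearIndependent_rep hPQ)
      apply crossProduct_ne_zero_iff_linearIndependent.mpr hli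
      rw [hs P hP, hs Q hQ]
      ext l
      simp only [cross_apply]
      fin_cases l
      · simp; linear_combination (e₀ 2 * e₁ 1 - e₀ 1 * e₁ 2) * h0
      · simp; linear_combination (e₀ 0 * e₁ 2 - e₀ 2 * e₁ 0) * h0
      · simp; linear_combination (e₀ 1 * e₁ 0 - e₀ 0 * e₁ 1) * h0
    · intro P hP
      rw [eval_restrictToLine, ← hs P hP, hDS P hP]
  constructor
  · rintro m ⟨t, ht⟩
    apply eval_cofactor_vertex_ne_zero hk hv hN hD m
    rw [ht, ← eval_restrictToLine, hD0, map_zero]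
  · have := congr(restrictToLine e₀ e₁ $hD)
    rwa [map_prod, map_add, map_prod, map_mul, hD0, mul_zero, add_zero] at this

/-- With `a` the restriction of the form of a red line, `x` is a point where that line meets `G`. -/
lemma exists_projective_point {e₀ e₁ : Fin 3 → K} (he : LinearIndependent K ![e₀, e₁])
    (N : (Fin 3 → K) ≃ₗ[K] (Fin 3 → K)) (a : Fin 2 → K) :
    ∃ (x : ProjPlane K) (s : Fin 2 → K), N x.rep = s 0 • e₀ + s 1 • e₁ ∧ a ⬝ᵥ s = 0 := by
  obtain ⟨t, ht, hat⟩ : ∃ t : Fin 2 → K, t ≠ 0 ∧ a ⬝ᵥ t = 0 := by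
    by_cases ha : a = 0
    · exact ⟨1, one_ne_zero, by simp [ha]⟩
    · refine ⟨![a 1, -a 0], fun h => ha ?_, by simp [dotProduct, mul_comm]⟩
      have h1 := congr_fun h 0
      have h2 := congr_fun h 1
      ext l
      fin_cases l
      · simpa using h2
      · simpa using h1
  have hne : N.symm (t 0 • e₀ + t 1 • e₁) ≠ 0 := by
    rw [ne_eq, map_eq_zero_iff _ N.symm.injective]
    intro h
    obtain ⟨h0, h1⟩ := LinearIndependent.pair_iff.mp he _ _ h
    exact ht (by ext l; fin_cases l <;> simpa)
  obtain ⟨u, hu⟩ := Projectivization.exists_smul_eq_mk_rep K _ hne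
  refine ⟨Projectivization.mk K _ hne, (u : K) • t, ?_, by rw [dotProduct_smul, hat, smul_zero]⟩
  rw [← hu, Units.smul_def, map_smul, N.apply_symm_apply, smul_add, smul_smul, smul_smul]
  rfl

/-- If a line contains `k - 1` crossing points and no further one, then one of them lies on two
red and on two blue lines. -/
theorem exists_mem_two_lines (hk : 2 ≤ k) (hv : Function.Injective v)
    (hN : ∀ m, N (v m).rep = c m • veronese (p m)) {e₀ e₁ : Fin 3 → K}
    (he : LinearIndependent K ![e₀, e₁])
    {S : Finset (ProjPlane K)} (hcard : S.card = k - 1) (hS : ∀ P ∈ S, P ∈ crossingPoints v)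
    (hSG : ∀ P ∈ S, ∃ s : Fin 2 → K, N P.rep = s 0 • e₀ + s 1 • e₁)
    (hmax : ∀ P ∈ crossingPoints v, (∃ s : Fin 2 → K, N P.rep = s 0 • e₀ + s 1 • e₁) → P ∈ S) :
    ∃ x ∈ S, (∃ i i' : Fin k, i ≠ i' ∧ x ∈ redLine v i ∧ x ∈ redLine v i') ∧
      (∃ j j' : Fin k, j ≠ j' ∧ x ∈ blueLine v j ∧ x ∈ blueLine v j') := by
  obtain ⟨hG, hprod⟩ := prod_restrictToLine_eq hk hv hN hcard hS hSG
  simp only [restrictToLine_linForm] at hprod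
  have hne {a b : ℕ} (h : (a : ZMod (2 * k)) ≠ b) :
      ![chord (p a) (p b) ⬝ᵥ e₀, chord (p a) (p b) ⬝ᵥ e₁] ≠ 0 := by
    intro h0
    -- A side whose form vanishes on all of `G` would be `G` itself, but `G` contains no vertex.
    exact hG a (exists_combination_of_dotProduct_eq_zero he
      (chord_ne_zero (hv.ne h) (hN a) (hN b)) (congr_fun h0 0) (congr_fun h0 1)
      ((chord_dotProduct_vertex_eq_zero_iff hv hN a b a).mpr (Or.inl rfl)))
  have hred (i : Fin k) := hne (a := 2 * i.val) (b := 2 * i.val + 1)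
    (by rw [ne_eq, natCast_eq_natCast_iff_of_le] <;> omega)
  have hblue (i : Fin k) := hne (a := 2 * i.val + 1) (b := 2 * i.val + 2)
    (by rw [ne_eq, natCast_eq_natCast_iff_of_le] <;> omega)
  choose x s hxs hxr using fun i : Fin k => exists_projective_point he N
    ![chord (p (2 * i.val : ℕ)) (p (2 * i.val + 1 : ℕ)) ⬝ᵥ e₀,
      chord (p (2 * i.val : ℕ)) (p (2 * i.val + 1 : ℕ)) ⬝ᵥ e₁]
  have hxred (i : Fin k) : x i ∈ redLine v i := by
    rw [mem_redLine_iff hk hv hN, hxs, dotProduct_line_combination, hxr]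
  have hxblue {i j : Fin k}
      (h : linForm ![chord (p (2 * i.val : ℕ)) (p (2 * i.val + 1 : ℕ)) ⬝ᵥ e₀,
        chord (p (2 * i.val : ℕ)) (p (2 * i.val + 1 : ℕ)) ⬝ᵥ e₁] ∣
        linForm ![chord (p (2 * j.val + 1 : ℕ)) (p (2 * j.val + 2 : ℕ)) ⬝ᵥ e₀,
        chord (p (2 * j.val + 1 : ℕ)) (p (2 * j.val + 2 : ℕ)) ⬝ᵥ e₁]) : x i ∈ blueLine v j := by
    rw [mem_blueLine_iff hv hN, hxs, dotProduct_line_combination]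
    exact dotProduct_eq_zero_of_linForm_dvd h (hxr i)
  have hxS (i : Fin k) : x i ∈ S := by
    obtain ⟨j, hj⟩ := exists_linForm_dvd hred hprod i
    refine hmax _ ⟨⟨i, hxred i⟩, ⟨j, hxblue hj⟩, ?_⟩ ⟨_, hxs i⟩
    rintro ⟨m, hm⟩
    exact hG m ⟨s i, by rw [hm, hxs]⟩
  -- Pigeonhole: `k` red lines meet `G` in the `k - 1` points of `S`.
  obtain ⟨i, -, i', -, hi, hxi⟩ := Finset.exists_ne_map_eq_of_card_lt_of_maps_to
    (s := Finset.univ) (t := S) (by rw [hcard, Finset.card_univ, Fintype.card_fin]; omega)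
    (f := x) fun i _ => hxS i
  obtain ⟨j, j', hj, hij, hij'⟩ := exists_two_linForm_dvd hred hblue hprod hi
  exact ⟨x i, hxS i, ⟨i, i', hi, hxred i, hxi ▸ hxred i'⟩, j, j', hj, hxblue hij,
    hxi ▸ hxblue hij'⟩

end Main

theorem mainTheorem2 {K : Type*} [Field K] (k : ℕ) (hk : 2 ≤ k)
    (F : MvPolynomial (Fin 3) K) (hF : F.IsHomogeneous 2) (hirr : Irreducible F)
    (v : ZMod (2 * k) → ProjPlane K) (hv : Function.Injective v)
    (hconic : ∀ m, v m ∈ planeCurve F)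
    (G : Set (ProjPlane K)) (hG : IsPlaneLine G)
    (S : Finset (ProjPlane K)) (hcard : S.card = k - 1)
    (hS : ∀ P ∈ S, P ∈ crossingPoints v) (hSG : ∀ P ∈ S, P ∈ G) :
    -- if the crossing points are `k² - 2k` in number, a further one lies on `G`
    ((crossingPoints v).ncard = k ^ 2 - 2 * k →
      ∃ X ∈ crossingPoints v, X ∉ S ∧ X ∈ G) ∧
    -- without that: a further one lies on `G`, or one in `S` has to be counted repeatedly
    ((∃ X ∈ crossingPoints v, X ∉ S ∧ X ∈ G) ∨
      ∃ X ∈ S,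
        (∃ i i' : Fin k, i ≠ i' ∧ X ∈ redLine v i ∧ X ∈ redLine v i') ∧
        (∃ j j' : Fin k, j ≠ j' ∧ X ∈ blueLine v j ∧ X ∈ blueLine v j')) := by
  have hne {a b : ℕ} (ha : a < 2 * k) (hb : b < 2 * k) (hab : a ≠ b) :
      (a : ZMod (2 * k)) ≠ b := by
    rw [ne_eq, natCast_eq_natCast_iff_of_le] <;> omega
  obtain ⟨N, p, c, hN⟩ := exists_conic_parametrization hF hirr hv hconic
    (hne (a := 0) (b := 1) (by omega) (by omega) (by omega))
    (hne (a := 0) (b := 2) (by omega) (by omega) (by omega))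
    (hne (a := 1) (b := 2) (by omega) (by omega) (by omega))
  obtain ⟨a, ha, rfl⟩ := hG
  obtain ⟨e₀, e₁, he, hline⟩ := exists_line_basis ha N
  have key : (∃ X ∈ crossingPoints v, X ∉ S ∧ X ∈ {P : ProjPlane K | a ⬝ᵥ P.rep = 0}) ∨
      ∃ X ∈ S,
        (∃ i i' : Fin k, i ≠ i' ∧ X ∈ redLine v i ∧ X ∈ redLine v i') ∧
        (∃ j j' : Fin k, j ≠ j' ∧ X ∈ blueLine v j ∧ X ∈ blueLine v j') := by
    refine or_iff_not_imp_left.mpr fun hno => ?_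
    refine exists_mem_two_lines hk hv hN he hcard hS (fun P hP => (hline _).mp (hSG P hP))
      fun P hP hPG => ?_
    by_contra hPS
    exact hno ⟨P, hP, hPS, (hline _).mpr hPG⟩
  refine ⟨fun hΓ => ?_, key⟩
  rcases key with h | ⟨x, hx, ⟨i, i', hi, hxi, hxi'⟩, j, -, -, hxj, -⟩
  · exact h
  · exact absurd hΓ (ncard_crossingPoints_lt hk hv hN (hS x hx) hi hxi hxi' hxj).ne
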